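/- Call a finite set $S\subset\mathbb{Z}^2$ a constellation. For $k\ge 1$, a pattern of length $k$ in $S$ is a block of exactly $k$ consecutive points of $S$ in one of the four directions $d\in\{(1,0),(0,1),(1,1),(1,-1)\}$ (horizontal, vertical, two diagonals), i.e. points $p,p+d,\dots,p+(k-1)d\in S$ with $p-d\notin S$ and $p+kd\notin S$; patterns in different directions are counted as different, so an isolated point gives four patterns of length $1$. Let $a_k(n)$ be the minimal number of points of a constellation that contains (at least) $n$ patterns of length $k$. Then for every integer $k\ge 1$ the limit $$f(k)=\lim_{n\to\infty}\frac{a_k(n)}{n}$$ exists, and: 1. if $k\ge 2$, then $f(k)\le\dfrac{k(k+1)+2}{4(k-1)}$; 2. if $k+1$ is divisible by neither $3$ nor $4$, then $f(k)\le\dfrac{k(k+1)+1}{4k}$. -/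

import Mathlib

open Filter Topology

/-- The horizontal, the vertical and the two diagonal directions of the square grid, one step vector
for each (the opposite vector describes the same direction). -/
def gridDirections : Finset (ℤ × ℤ) := {(1, 0), (0, 1), (1, 1), (1, -1)}

/-- `IsPatternAt k S d p`: the `k` grid positions `p, p + d, …, p + (k - 1) d` all carry a point of
the constellation `S`, and the two positions flanking this block are empty. -/
def IsPatternAt (k : ℕ) (S : Finset (ℤ × ℤ)) (d p : ℤ × ℤ) : Prop :=
  (∀ i : ℕ, i < k → p + i • d ∈ S) ∧ p - d ∉ S ∧ p + k • d ∉ S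

instance (k : ℕ) (S : Finset (ℤ × ℤ)) (d p : ℤ × ℤ) : Decidable (IsPatternAt k S d p) := by
  unfold IsPatternAt
  infer_instance

/-- The patterns of length `k ≥ 1` of a finite constellation `S`, each recorded by its direction and
its first point. An isolated point gives four patterns of length `1`. -/
def patterns (k : ℕ) (S : Finset (ℤ × ℤ)) : Finset ((ℤ × ℤ) × (ℤ × ℤ)) :=
  (gridDirections ×ˢ S).filter fun q => IsPatternAt k S q.1 q.2

/-- `a_k(n)`: the minimal number of points of a constellation that forms `n` patterns of length `k`
(it may form more). -/
noncomputable def minPoints (k n : ℕ) : ℕ :=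
  sInf {m : ℕ | ∃ S : Finset (ℤ × ℤ), S.card = m ∧ n ≤ (patterns k S).card}

/-- `f(k) = lim a_k(n) / n` as `n → ∞`. -/
noncomputable def patternDensity (k : ℕ) : ℝ :=
  limUnder atTop fun n : ℕ => (minPoints k n : ℝ) / n

/-! Constellations placed side by side, two columns apart, do not disturb each other's patterns, so
`minPoints k` is subadditive. Fekete's lemma gives the limit and identifies it with an infimum:
every single constellation bounds `patternDensity k` by points per pattern.

For the bounds, put n = k + 1 and fill a large square except for an n-periodic set of holes with
residues H. A hole alone on its torus line in direction d recurs along that line exactly every n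
steps, leaving k filled points between copies: one pattern. Boundary effects vanish in the limit,
which leaves (n² - |H|) / |`loneOnLine n H`|.

It remains to place nearly n queens on the toroidal board with few attacks. If n is coprime to 6,
the points (t, 2t) give k / 4. Otherwise piecewise constant shifts repair y and x + y, while x and y
- x each fail for at most four points. If n = 2m with m coprime to 6, a set of n - 1 queens has no
attacks at all. -/

/-! ### Subadditivity and existence of the limit -/

theorem abs_fst_le_one_of_mem_gridDirections {d : ℤ × ℤ} (hd : d ∈ gridDirections) :
    -1 ≤ d.1 ∧ d.1 ≤ 1 ∧ -1 ≤ d.2 ∧ d.2 ≤ 1 := by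
  simp only [gridDirections, Finset.mem_insert, Finset.mem_singleton] at hd
  rcases hd with rfl | rfl | rfl | rfl <;> simp

/-- A grid step changes the first coordinate by at most 1, so the flanking positions of a pattern in
`S` cannot reach `T`. -/
theorem IsPatternAt.union_of_separated {k : ℕ} (hk : 1 ≤ k) {S T : Finset (ℤ × ℤ)} {d p : ℤ × ℤ}
    (hd : d ∈ gridDirections) (hp : IsPatternAt k S d p)
    (hST : ∀ s ∈ S, ∀ t ∈ T, 2 ≤ |t.1 - s.1|) : IsPatternAt k (S ∪ T) d p := by
  obtain ⟨hin, hl, hr⟩ := hp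
  obtain ⟨h1, h2, -, -⟩ := abs_fst_le_one_of_mem_gridDirections hd
  refine ⟨fun i hi => Finset.mem_union_left _ (hin i hi), fun h => ?_, fun h => ?_⟩
  · rcases Finset.mem_union.1 h with h | h
    · exact hl h
    · have := hST _ (hin 0 (by omega)) _ h
      simp at this
      rcases le_abs.1 this with h | h <;> omega
  · rcases Finset.mem_union.1 h with h | h
    · exact hr h
    · obtain ⟨j, rfl⟩ : ∃ j, k = j + 1 := ⟨k - 1, by omega⟩
      have := hST _ (hin j (by omega)) _ h
      simp [add_mul] at this
      rcases le_abs.1 this with h | h <;> linarith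

theorem card_patterns_union_of_separated {k : ℕ} (hk : 1 ≤ k) {S T : Finset (ℤ × ℤ)}
    (hST : ∀ s ∈ S, ∀ t ∈ T, 2 ≤ |t.1 - s.1|) :
    (patterns k S).card + (patterns k T).card ≤ (patterns k (S ∪ T)).card := by
  have hdisj : Disjoint (patterns k S) (patterns k T) := by
    rw [Finset.disjoint_left]
    rintro ⟨d, p⟩ h1 h2
    simp only [patterns, Finset.mem_filter, Finset.mem_product] at h1 h2
    have := hST p h1.1.2 p h2.1.2
    simp at this
  rw [← Finset.card_union_of_disjoint hdisj]
  apply Finset.card_le_card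
  rintro ⟨d, p⟩ h
  simp only [patterns, Finset.mem_filter, Finset.mem_product, Finset.mem_union] at h ⊢
  rcases h with h | h
  · exact ⟨⟨h.1.1, Or.inl h.1.2⟩, h.2.union_of_separated hk h.1.1 hST⟩
  · refine ⟨⟨h.1.1, Or.inr h.1.2⟩, ?_⟩
    rw [Finset.union_comm]
    refine h.2.union_of_separated hk h.1.1 fun s hs t ht => ?_
    rw [abs_sub_comm]
    exact hST t ht s hs

theorem card_patterns_le_map_addRight (k : ℕ) (S : Finset (ℤ × ℤ)) (v : ℤ × ℤ) :
    (patterns k S).card ≤ (patterns k (S.map (addRightEmbedding v))).card := by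
  have key : ∀ q : ℤ × ℤ, q + v ∈ S.map (addRightEmbedding v) ↔ q ∈ S := fun q => by
    simp
  apply Finset.card_le_card_of_injOn (fun q => (q.1, q.2 + v))
  · rintro ⟨d, p⟩ h
    simp only [patterns, Finset.coe_filter, Finset.mem_product, Set.mem_ofPred_eq] at h ⊢
    refine ⟨⟨h.1.1, (key p).2 h.1.2⟩, fun i hi => ?_, ?_, ?_⟩
    · rw [add_right_comm, key]
      exact h.2.1 i hi
    · rw [add_sub_right_comm, key]
      exact h.2.2.1
    · rw [add_right_comm, key]
      exact h.2.2.2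
  · rintro ⟨d, p⟩ - ⟨d', p'⟩ - h
    simpa using h

theorem exists_card_eq_add_patterns {k : ℕ} (hk : 1 ≤ k) (S T : Finset (ℤ × ℤ)) :
    ∃ R : Finset (ℤ × ℤ), R.card = S.card + T.card ∧
      (patterns k S).card + (patterns k T).card ≤ (patterns k R).card := by
  obtain ⟨a, ha⟩ : ∃ a : ℤ, ∀ s ∈ S, s.1 ≤ a := by
    obtain ⟨a, ha⟩ := (S.image Prod.fst).bddAbove
    exact ⟨a, fun s hs => ha (by simpa using ⟨s.2, hs⟩)⟩
  obtain ⟨b, hb⟩ : ∃ b : ℤ, ∀ t ∈ T, b ≤ t.1 := by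
    obtain ⟨b, hb⟩ := (T.image Prod.fst).bddBelow
    exact ⟨b, fun t ht => hb (by simpa using ⟨t.2, ht⟩)⟩
  set v : ℤ × ℤ := (a - b + 2, 0)
  set T' := T.map (addRightEmbedding v) with hT'
  have hST : ∀ s ∈ S, ∀ t ∈ T', 2 ≤ |t.1 - s.1| := by
    intro s hs t ht
    simp only [hT', Finset.mem_map, addRightEmbedding_apply] at ht
    obtain ⟨t, ht, rfl⟩ := ht
    have h1 := ha s hs
    have h2 := hb t ht
    refine le_trans ?_ (le_abs_self _)
    simp [v]
    linarith
  refine ⟨S ∪ T', ?_, le_trans ?_ (card_patterns_union_of_separated hk hST)⟩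
  · rw [Finset.card_union_of_disjoint, hT', Finset.card_map]
    rw [Finset.disjoint_left]
    intro p h1 h2
    have := hST p h1 p h2
    simp at this
  · exact Nat.add_le_add_left (card_patterns_le_map_addRight k T v) _

theorem exists_one_le_card_patterns {k : ℕ} (hk : 1 ≤ k) :
    ∃ S : Finset (ℤ × ℤ), 1 ≤ (patterns k S).card := by
  refine ⟨(Finset.range k).image fun i : ℕ => ((i : ℤ), (0 : ℤ)), ?_⟩
  rw [Nat.one_le_iff_ne_zero, Finset.card_ne_zero]
  refine ⟨((1, 0), (0, 0)), ?_⟩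
  simp only [patterns, Finset.mem_filter, Finset.mem_product, gridDirections]
  refine ⟨⟨by simp, ?_⟩, fun i hi => ?_, ?_, ?_⟩
  · simp only [Finset.mem_image, Finset.mem_range]
    exact ⟨0, by omega, by simp⟩
  · simp only [Finset.mem_image, Finset.mem_range]
    exact ⟨i, hi, by simp⟩
  · simp only [Finset.mem_image, Finset.mem_range, not_exists, not_and]
    intro i _ h
    simp at h
  · simp only [Finset.mem_image, Finset.mem_range, not_exists, not_and]
    intro i hi h
    simp at h
    omega

/-- Excludes the default value `sInf ∅ = 0` in `minPoints`, so that the minimum is attained. -/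
theorem exists_le_card_patterns {k : ℕ} (hk : 1 ≤ k) (n : ℕ) :
    ∃ S : Finset (ℤ × ℤ), n ≤ (patterns k S).card := by
  induction n with
  | zero => exact ⟨∅, Nat.zero_le _⟩
  | succ n ih =>
    obtain ⟨S, hS⟩ := ih
    obtain ⟨T, hT⟩ := exists_one_le_card_patterns hk
    obtain ⟨R, -, hR⟩ := exists_card_eq_add_patterns hk S T
    exact ⟨R, by omega⟩

theorem exists_card_eq_minPoints {k : ℕ} (hk : 1 ≤ k) (n : ℕ) :
    ∃ S : Finset (ℤ × ℤ), S.card = minPoints k n ∧ n ≤ (patterns k S).card := by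
  obtain ⟨S, hS⟩ := exists_le_card_patterns hk n
  exact Nat.sInf_mem (s := {m : ℕ | ∃ S : Finset (ℤ × ℤ), S.card = m ∧ n ≤ (patterns k S).card})
    ⟨S.card, S, rfl, hS⟩

theorem minPoints_le_card {k n : ℕ} {S : Finset (ℤ × ℤ)} (h : n ≤ (patterns k S).card) :
    minPoints k n ≤ S.card :=
  Nat.sInf_le ⟨S, rfl, h⟩

theorem subadditive_minPoints {k : ℕ} (hk : 1 ≤ k) :
    Subadditive fun n => (minPoints k n : ℝ) := by
  intro m n
  obtain ⟨S, hS, hS'⟩ := exists_card_eq_minPoints hk m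
  obtain ⟨T, hT, hT'⟩ := exists_card_eq_minPoints hk n
  obtain ⟨R, hR, hR'⟩ := exists_card_eq_add_patterns hk S T
  have : minPoints k (m + n) ≤ R.card := minPoints_le_card (by omega)
  rw [hR, hS, hT] at this
  show ((minPoints k (m + n) : ℕ) : ℝ) ≤ minPoints k m + minPoints k n
  exact_mod_cast this

theorem bddBelow_minPoints_div (k : ℕ) :
    BddBelow (Set.range fun n : ℕ => (minPoints k n : ℝ) / n) :=
  ⟨0, by rintro _ ⟨n, rfl⟩; positivity⟩

theorem patternDensity_eq_lim {k : ℕ} (hk : 1 ≤ k) :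
    patternDensity k = (subadditive_minPoints hk).lim :=
  ((subadditive_minPoints hk).tendsto_lim (bddBelow_minPoints_div k)).limUnder_eq

theorem tendsto_minPoints_div {k : ℕ} (hk : 1 ≤ k) :
    Tendsto (fun n : ℕ => (minPoints k n : ℝ) / n) atTop (𝓝 (patternDensity k)) := by
  rw [patternDensity_eq_lim hk]
  exact (subadditive_minPoints hk).tendsto_lim (bddBelow_minPoints_div k)

theorem patternDensity_le_div {k n : ℕ} (hk : 1 ≤ k) (hn : n ≠ 0) {S : Finset (ℤ × ℤ)}
    (h : n ≤ (patterns k S).card) : patternDensity k ≤ (S.card : ℝ) / n := by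
  rw [patternDensity_eq_lim hk]
  refine ((subadditive_minPoints hk).lim_le_div (bddBelow_minPoints_div k) hn).trans ?_
  gcongr
  exact minPoints_le_card h

/-! ### Periodic constellations with holes -/

/-- Reduction of a grid point modulo `n`. -/
noncomputable def gridMod (n : ℕ) (p : ℤ × ℤ) : ZMod n × ZMod n := (p.1, p.2)

/-- The points of the square `[0, n m)²` that do not reduce modulo `n` into `H`. -/
noncomputable def puncturedSquare (n m : ℕ) (H : Finset (ZMod n × ZMod n)) : Finset (ℤ × ℤ) :=
  (Finset.Ico (0 : ℤ) (n * m) ×ˢ Finset.Ico (0 : ℤ) (n * m)).filter fun p => gridMod n p ∉ H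

/-- The pairs `(d, h)` such that `h` is the only point of `H` on its line of direction `d` in the
torus `(ℤ/n)²`. -/
noncomputable def loneOnLine (n : ℕ) (H : Finset (ZMod n × ZMod n)) :
    Finset ((ℤ × ℤ) × (ZMod n × ZMod n)) :=
  (gridDirections ×ˢ H).filter fun q =>
    ∀ i : Fin n, gridMod n ((i : ℕ) • q.1) + q.2 ∈ H → (i : ℕ) = 0

theorem gridMod_add (n : ℕ) (p q : ℤ × ℤ) : gridMod n (p + q) = gridMod n p + gridMod n q := by
  simp [gridMod]

theorem gridMod_nsmul_self (n : ℕ) (d : ℤ × ℤ) : gridMod n (n • d) = 0 := by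
  simp [gridMod]

theorem card_puncturedSquare_le (n m : ℕ) [NeZero n] (H : Finset (ZMod n × ZMod n)) :
    (puncturedSquare n m H).card ≤ m * m * (n * n - H.card) := by
  have hn : (0 : ℤ) < n := by exact_mod_cast Nat.pos_of_neZero n
  have : (puncturedSquare n m H).card ≤
      ((Finset.Ico (0 : ℤ) m ×ˢ Finset.Ico (0 : ℤ) m) ×ˢ Hᶜ).card := by
    -- Division with remainder: a point is determined by its n × n cell and its residue.
    apply Finset.card_le_card_of_injOn fun p : ℤ × ℤ => ((p.1 / n, p.2 / n), gridMod n p)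
    · rintro ⟨x, y⟩ h
      simp only [puncturedSquare, Finset.coe_filter, Finset.mem_product, Finset.mem_Ico,
        Set.mem_ofPred_eq] at h
      simp only [Finset.mem_coe, Finset.mem_product, Finset.mem_Ico, Finset.mem_compl]
      refine ⟨⟨⟨?_, ?_⟩, ?_, ?_⟩, h.2⟩
      · exact Int.ediv_nonneg h.1.1.1 hn.le
      · exact Int.ediv_lt_of_lt_mul hn (by linarith)
      · exact Int.ediv_nonneg h.1.2.1 hn.le
      · exact Int.ediv_lt_of_lt_mul hn (by linarith)
    · rintro ⟨x, y⟩ - ⟨x', y'⟩ - h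
      simp only [gridMod, Prod.mk.injEq] at h
      obtain ⟨⟨h1, h2⟩, h3, h4⟩ := h
      have h3' : x % n = x' % n := (ZMod.intCast_eq_intCast_iff _ _ _).1 h3
      have h4' : y % n = y' % n := (ZMod.intCast_eq_intCast_iff _ _ _).1 h4
      rw [Prod.mk.injEq]
      constructor
      · rw [← Int.emod_add_mul_ediv x n, ← Int.emod_add_mul_ediv x' n, h1, h3']
      · rw [← Int.emod_add_mul_ediv y n, ← Int.emod_add_mul_ediv y' n, h2, h4']
  refine this.trans (le_of_eq ?_)
  simp [Finset.card_product, Finset.card_compl, ZMod.card]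

/-- Each lone pair yields a pattern for every one of the m² interior cells; the border of one cell
on each side keeps the n steps from a hole inside the square. -/
theorem card_patterns_puncturedSquare_ge {k n : ℕ} (hk : 1 ≤ k) (hn : n = k + 1) (m : ℕ)
    (H : Finset (ZMod n × ZMod n)) :
    m * m * (loneOnLine n H).card ≤ (patterns k (puncturedSquare n (m + 2) H)).card := by
  have : NeZero n := ⟨by omega⟩
  have hn0 : (0 : ℤ) < n := by omega
  let rep : ZMod n × ZMod n → ℤ × ℤ → ℤ × ℤ := fun h i =>
    ((h.1.val : ℤ) + n * i.1, (h.2.val : ℤ) + n * i.2)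
  have hrep : ∀ h i, gridMod n (rep h i) = h := fun h i => by
    simp [rep, gridMod]
  have hcard : m * m * (loneOnLine n H).card =
      (loneOnLine n H ×ˢ (Finset.Ico (1 : ℤ) (m + 1) ×ˢ Finset.Ico (1 : ℤ) (m + 1))).card := by
    simp [Finset.card_product, mul_comm]
  rw [hcard]
  -- The pattern starts one step after the hole; its flanks are this hole and the copy n steps on.
  apply Finset.card_le_card_of_injOn fun q => (q.1.1, rep q.1.2 q.2 + q.1.1)
  · rintro ⟨⟨d, h⟩, i, j⟩ hq
    simp only [loneOnLine, Finset.coe_product, Finset.coe_filter, Finset.mem_product,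
      Set.mem_prod, Set.mem_ofPred_eq, Finset.coe_Ico, Set.mem_Ico] at hq
    obtain ⟨⟨⟨hd, hh⟩, hlone⟩, ⟨hi1, hi2⟩, hj1, hj2⟩ := hq
    obtain ⟨hd1, hd2, hd3, hd4⟩ := abs_fst_le_one_of_mem_gridDirections hd
    have hmem : ∀ l : ℕ, l < k → rep h (i, j) + d + l • d ∈ puncturedSquare n (m + 2) H := by
      intro l hl
      have e : rep h (i, j) + d + l • d = rep h (i, j) + (l + 1) • d := by
        rw [add_smul, one_smul, add_assoc, add_comm d]
      rw [e]
      simp only [puncturedSquare, Finset.mem_filter, Finset.mem_product, Finset.mem_Ico]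
      refine ⟨?_, fun hmem => ?_⟩
      · have b1 : (h.1.val : ℤ) < n := by exact_mod_cast ZMod.val_lt h.1
        have b2 : (h.2.val : ℤ) < n := by exact_mod_cast ZMod.val_lt h.2
        have c1 : (n : ℤ) * 1 ≤ n * i := by gcongr
        have c2 : (n : ℤ) * 1 ≤ n * j := by gcongr
        have c3 : (n : ℤ) * i ≤ n * m := by gcongr; omega
        have c4 : (n : ℤ) * j ≤ n * m := by gcongr; omega
        have l1 : ((l : ℤ) + 1) ≤ n := by omega
        have e1 : ((l : ℤ) + 1) * d.1 ≤ n := by nlinarith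
        have e2 : -(n : ℤ) ≤ ((l : ℤ) + 1) * d.1 := by nlinarith
        have e3 : ((l : ℤ) + 1) * d.2 ≤ n := by nlinarith
        have e4 : -(n : ℤ) ≤ ((l : ℤ) + 1) * d.2 := by nlinarith
        have z1 : (0 : ℤ) ≤ h.1.val := Int.natCast_nonneg _
        have z2 : (0 : ℤ) ≤ h.2.val := Int.natCast_nonneg _
        simp [rep, -ZMod.natCast_val]
        refine ⟨⟨?_, ?_⟩, ?_, ?_⟩ <;> linarith
      · rw [gridMod_add, hrep, add_comm] at hmem
        have := hlone ⟨l + 1, by omega⟩ hmem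
        simp at this
    simp only [patterns, Finset.coe_filter, Finset.mem_product, Set.mem_ofPred_eq]
    refine ⟨⟨hd, ?_⟩, hmem, fun hmem => ?_, fun hmem => ?_⟩
    · simpa using hmem 0 hk
    · simp only [puncturedSquare, Finset.mem_filter] at hmem
      rw [add_sub_cancel_right, hrep] at hmem
      exact hmem.2 hh
    · simp only [puncturedSquare, Finset.mem_filter] at hmem
      have e : rep h (i, j) + d + k • d = rep h (i, j) + n • d := by
        rw [hn, add_smul, one_smul, add_assoc, add_comm d]
      rw [e, gridMod_add, hrep, gridMod_nsmul_self, add_zero] at hmem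
      exact hmem.2 hh
  · rintro ⟨⟨d, h⟩, i⟩ - ⟨⟨d', h'⟩, i'⟩ - hq
    simp only [Prod.mk.injEq] at hq
    obtain ⟨rfl, hq⟩ := hq
    have hq := add_right_cancel hq
    have hh : h = h' := by rw [← hrep h i, hq, hrep]
    subst hh
    simp only [rep, Prod.mk.injEq, add_right_inj, mul_eq_mul_left_iff] at hq
    have : i = i' := by
      ext
      · exact hq.1.resolve_right hn0.ne'
      · exact hq.2.resolve_right hn0.ne'
    rw [this]

theorem patternDensity_le_of_loneOnLine {k : ℕ} (hk : 1 ≤ k)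
    (H : Finset (ZMod (k + 1) × ZMod (k + 1))) (hH : 0 < (loneOnLine (k + 1) H).card) :
    patternDensity k ≤ (((k + 1) * (k + 1) - H.card : ℕ) : ℝ) / (loneOnLine (k + 1) H).card := by
  set c := (k + 1) * (k + 1) - H.card
  set u := (loneOnLine (k + 1) H).card
  -- The factor is ((m + 3) / (m + 1))²: all cells over interior cells.
  have hle : ∀ m : ℕ, patternDensity k ≤ (1 + 2 / ((m : ℝ) + 1)) ^ 2 * (c / u) := by
    intro m
    have h1 := patternDensity_le_div hk (by positivity)
      (card_patterns_puncturedSquare_ge hk rfl (m + 1) H)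
    refine h1.trans ?_
    have h2 : ((puncturedSquare (k + 1) (m + 1 + 2) H).card : ℝ) ≤
        ((m + 1 + 2) * (m + 1 + 2) * c : ℕ) := by
      exact_mod_cast card_puncturedSquare_le (k + 1) (m + 1 + 2) H
    have hu : (0 : ℝ) < u := by exact_mod_cast hH
    calc _ ≤ (((m + 1 + 2) * (m + 1 + 2) * c : ℕ) : ℝ) / (((m + 1) * (m + 1) * u : ℕ) : ℝ) := by
          gcongr
      _ = _ := by push_cast; field_simp
  have hlim : Tendsto (fun m : ℕ => (1 + 2 / ((m : ℝ) + 1)) ^ 2 * ((c : ℝ) / u)) atTop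
      (𝓝 ((1 + 2 * 0) ^ 2 * ((c : ℝ) / u))) := by
    have := (tendsto_one_div_add_atTop_nhds_zero_nat (𝕜 := ℝ)).const_mul 2
    refine (((this.congr fun m => ?_).const_add 1).pow 2).mul_const _
    ring
  simpa using ge_of_tendsto' hlim hle

/-! ### Queens on the torus -/

/-- The points `(x t, y t)`, `t < N`, of the torus `(ℤ/n)²`. -/
noncomputable def torusPoints (n N : ℕ) (x y : ℕ → ℤ) : Finset (ZMod n × ZMod n) :=
  (Finset.range N).image fun t => gridMod n (x t, y t)

theorem gridMod_eq_gridMod_iff {n : ℕ} {p q : ℤ × ℤ} :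
    gridMod n p = gridMod n q ↔ (n : ℤ) ∣ p.1 - q.1 ∧ (n : ℤ) ∣ p.2 - q.2 := by
  rw [gridMod, gridMod, Prod.mk.injEq, eq_comm, ZMod.intCast_eq_intCast_iff_dvd_sub, eq_comm,
    ZMod.intCast_eq_intCast_iff_dvd_sub]

section TorusPoints

variable {n N : ℕ} {x y : ℕ → ℤ}

theorem injOn_torusPoints (hy : ∀ t < N, ∀ t' < N, (n : ℤ) ∣ y t - y t' → t = t') :
    Set.InjOn (fun t => gridMod n (x t, y t)) (Finset.range N) := by
  intro t ht t' ht' h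
  rw [Finset.mem_coe, Finset.mem_range] at ht ht'
  exact hy t ht t' ht' (gridMod_eq_gridMod_iff.1 h).2

theorem card_torusPoints (hy : ∀ t < N, ∀ t' < N, (n : ℤ) ∣ y t - y t' → t = t') :
    (torusPoints n N x y).card = N := by
  rw [torusPoints, Finset.card_image_of_injOn (injOn_torusPoints hy), Finset.card_range]

/-- The form d.2 * x - d.1 * y is constant on lines of direction d, so its injectivity modulo n
makes points alone; `B` collects the exceptions. -/
theorem le_card_loneOnLine_torusPoints (B : Finset ((ℤ × ℤ) × ℕ))
    (hy : ∀ t < N, ∀ t' < N, (n : ℤ) ∣ y t - y t' → t = t')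
    (hB : ∀ d ∈ gridDirections, ∀ t < N, (d, t) ∉ B → ∀ t' < N,
      (n : ℤ) ∣ d.2 * (x t - x t') - d.1 * (y t - y t') → t = t') :
    4 * N ≤ (loneOnLine n (torusPoints n N x y)).card + B.card := by
  have h4 : 4 * N = (gridDirections ×ˢ Finset.range N).card := by
    rw [Finset.card_product, Finset.card_range]
    rfl
  rw [h4, ← Nat.sub_le_iff_le_add]
  refine (Finset.le_card_sdiff _ _).trans ?_
  apply Finset.card_le_card_of_injOn fun q => (q.1, gridMod n (x q.2, y q.2))
  · rintro ⟨d, t⟩ h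
    simp only [Finset.coe_sdiff, Set.mem_sdiff, Finset.mem_coe, Finset.mem_product,
      Finset.mem_range] at h
    obtain ⟨⟨hd, ht⟩, hdt⟩ := h
    simp only [loneOnLine, Finset.coe_filter, Finset.mem_product, Set.mem_ofPred_eq]
    refine ⟨⟨hd, Finset.mem_image_of_mem _ (Finset.mem_range.2 ht)⟩, fun i hi => ?_⟩
    obtain ⟨t', ht', h⟩ := Finset.mem_image.1 hi
    rw [Finset.mem_range] at ht'
    rw [← gridMod_add, eq_comm, gridMod_eq_gridMod_iff] at h
    rw [Prod.fst_add, Prod.snd_add, Prod.smul_fst, Prod.smul_snd, nsmul_eq_mul, nsmul_eq_mul] at h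
    obtain rfl := hB d hd t ht hdt t' ht' (by
      have := dvd_sub (h.1.mul_left d.2) (h.2.mul_left d.1)
      ring_nf at this ⊢
      exact this)
    rw [add_sub_cancel_right, add_sub_cancel_right] at h
    -- Every direction has a coordinate equal to 1.
    have hi' : (n : ℤ) ∣ (i : ℕ) := by
      simp only [gridDirections, Finset.mem_insert, Finset.mem_singleton] at hd
      rcases hd with rfl | rfl | rfl | rfl
      · simpa using h.1
      · simpa using h.2
      · simpa using h.1
      · simpa using h.1
    exact Nat.eq_zero_of_dvd_of_lt (by exact_mod_cast hi') i.2
  · rintro ⟨d, t⟩ h ⟨d', t'⟩ h' heq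
    simp only [Finset.coe_sdiff, Set.mem_sdiff, Finset.mem_coe, Finset.mem_product] at h h'
    rw [Prod.mk.injEq] at heq ⊢
    exact ⟨heq.1, injOn_torusPoints hy h.1.2 h'.1.2 heq.2⟩

end TorusPoints

theorem patternDensity_le_of_torusPoints {k n N : ℕ} (hk : 1 ≤ k) (hn : n = k + 1) {x y : ℕ → ℤ}
    (X D : Finset ℕ) (hN : X.card + D.card < 4 * N)
    (hx : ∀ t < N, t ∉ X → ∀ t' < N, (n : ℤ) ∣ x t - x t' → t = t')
    (hy : ∀ t < N, ∀ t' < N, (n : ℤ) ∣ y t - y t' → t = t')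
    (hs : ∀ t < N, ∀ t' < N, (n : ℤ) ∣ (x t + y t) - (x t' + y t') → t = t')
    (hd : ∀ t < N, t ∉ D → ∀ t' < N, (n : ℤ) ∣ (y t - x t) - (y t' - x t') → t = t') :
    patternDensity k ≤ (((k : ℝ) + 1) ^ 2 - N) / (4 * N - (X.card + D.card)) := by
  subst hn
  set B : Finset ((ℤ × ℤ) × ℕ) := {(0, 1)} ×ˢ X ∪ {(1, 1)} ×ˢ D with hBdef
  have hb : B.card ≤ X.card + D.card := by
    refine (Finset.card_union_le _ _).trans ?_
    simp
  have hB : ∀ d ∈ gridDirections, ∀ t < N, (d, t) ∉ B → ∀ t' < N,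
      ((k + 1 : ℕ) : ℤ) ∣ d.2 * (x t - x t') - d.1 * (y t - y t') → t = t' := by
    intro d hd' t ht hdt t' ht' h
    simp only [gridDirections, Finset.mem_insert, Finset.mem_singleton] at hd'
    rcases hd' with rfl | rfl | rfl | rfl
    · refine hy t ht t' ht' ((dvd_neg.2 h).trans (dvd_of_eq ?_))
      ring
    · refine hx t ht (fun h => hdt (by simp [hBdef, h])) t' ht' (h.trans (dvd_of_eq ?_))
      ring
    · refine hd t ht (fun h => hdt (by simp [hBdef, h])) t' ht' ((dvd_neg.2 h).trans (dvd_of_eq ?_))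
      ring
    · refine hs t ht t' ht' ((dvd_neg.2 h).trans (dvd_of_eq ?_))
      ring
  have h1 := le_card_loneOnLine_torusPoints B hy hB
  set H := torusPoints (k + 1) N x y with hH
  have hcard : H.card = N := card_torusPoints hy
  have hle : H.card ≤ (k + 1) * (k + 1) := by
    refine (Finset.card_le_univ H).trans (le_of_eq ?_)
    simp [ZMod.card]
  have hb' : (4 * N - (X.card + D.card) : ℝ) ≤ (loneOnLine (k + 1) H).card := by
    rw [sub_le_iff_le_add]
    exact_mod_cast h1.trans (Nat.add_le_add_left hb _)
  have hN' : (0 : ℝ) < 4 * N - (X.card + D.card) := by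
    rw [sub_pos]
    exact_mod_cast hN
  have h2 := patternDensity_le_of_loneOnLine hk H (by exact_mod_cast hN'.trans_le hb')
  refine h2.trans ?_
  rw [Nat.cast_sub hle, hcard]
  have e : (((k + 1) * (k + 1) : ℕ) : ℝ) - N = ((k : ℝ) + 1) ^ 2 - N := by push_cast; ring
  rw [e]
  refine div_le_div_of_nonneg_left ?_ hN' hb'
  rw [← e, sub_nonneg]
  exact_mod_cast hcard ▸ hle

/-! ### Arithmetic modulo n and step functions -/

theorem Int.eq_or_of_dvd_of_lt_two_mul {n a : ℤ} (h : n ∣ a) (h1 : -(2 * n) < a) (h2 : a < 2 * n) :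
    a = -n ∨ a = 0 ∨ a = n := by
  obtain ⟨c, rfl⟩ := h
  have hn : 0 < n := by linarith
  have c1 : -2 < c := by nlinarith
  have c2 : c < 2 := by nlinarith
  obtain rfl | rfl | rfl : c = -1 ∨ c = 0 ∨ c = 1 := by omega
  all_goals simp

theorem Int.eq_or_of_dvd_of_lt_three_mul {n a : ℤ} (h : n ∣ a) (h1 : -(3 * n) < a)
    (h2 : a < 3 * n) : a = -(2 * n) ∨ a = -n ∨ a = 0 ∨ a = n ∨ a = 2 * n := by
  obtain ⟨c, rfl⟩ := h
  have hn : 0 < n := by linarith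
  have c1 : -3 < c := by nlinarith
  have c2 : c < 3 := by nlinarith
  obtain rfl | rfl | rfl | rfl | rfl : c = -2 ∨ c = -1 ∨ c = 0 ∨ c = 1 ∨ c = 2 := by omega
  all_goals simp [mul_comm]

/-- If `a` is coprime to `n`, then multiplication by `a` is injective modulo `n`. -/
theorem eq_of_dvd_mul_sub {n a : ℤ} (h : IsCoprime n a) {t t' : ℕ} (ht : (t : ℤ) < n)
    (ht' : (t' : ℤ) < n) (hd : n ∣ a * ((t : ℤ) - t')) : t = t' := by
  have := Int.eq_zero_of_abs_lt_dvd (h.dvd_of_dvd_mul_left hd) (by rw [abs_lt]; omega)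
  omega

theorem isCoprime_two_of_odd {n : ℤ} (h : ¬ 2 ∣ n) : IsCoprime n 2 :=
  ((Int.prime_two.coprime_iff_not_dvd).2 h).symm

theorem isCoprime_three_of_not_dvd {n : ℤ} (h : ¬ 3 ∣ n) : IsCoprime n 3 :=
  ((Int.prime_three.coprime_iff_not_dvd).2 h).symm

/-- `0` on the first half of `[0, n)`, `1` on the second. -/
def halfStep (n t : ℕ) : ℤ := if 2 * t < n then 0 else 1

/-- `0`, `1`, `2` on the three thirds of `[0, n)`. -/
def thirdStep (n t : ℕ) : ℤ := if 3 * t < n then 0 else if 3 * t < 2 * n then 1 else 2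

theorem halfStep_spec (n t : ℕ) :
    2 * t < n ∧ halfStep n t = 0 ∨ n ≤ 2 * t ∧ halfStep n t = 1 := by
  unfold halfStep
  split_ifs <;> simp <;> omega

theorem thirdStep_spec (n t : ℕ) :
    3 * t < n ∧ thirdStep n t = 0 ∨ n ≤ 3 * t ∧ 3 * t < 2 * n ∧ thirdStep n t = 1 ∨
      2 * n ≤ 3 * t ∧ thirdStep n t = 2 := by
  unfold thirdStep
  split_ifs <;> simp <;> omega

/-! ### Queen placements by the residue of n = k + 1 -/

/-- For the points (t, 2t) the four forms x, y, x + y, y - x are t, 2t, 3t, t, all injective modulo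
n. -/
theorem patternDensity_le_of_coprime {k : ℕ} (hk : 1 ≤ k) (h2 : ¬ 2 ∣ k + 1) (h3 : ¬ 3 ∣ k + 1) :
    patternDensity k ≤ (k : ℝ) / 4 := by
  obtain ⟨n, hn⟩ : ∃ n, n = k + 1 := ⟨_, rfl⟩
  rw [← hn] at h2 h3
  have c2 : IsCoprime (n : ℤ) 2 := isCoprime_two_of_odd (by exact_mod_cast h2)
  have c3 : IsCoprime (n : ℤ) 3 := isCoprime_three_of_not_dvd (by exact_mod_cast h3)
  have c1 : IsCoprime (n : ℤ) 1 := isCoprime_one_right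
  have := patternDensity_le_of_torusPoints (N := n) hk hn (x := fun t => t) (y := fun t => 2 * t)
    ∅ ∅ (by simp; omega)
    (fun t ht _ t' ht' h => eq_of_dvd_mul_sub c1 (t := t) (t' := t') (by omega) (by omega)
      (h.trans (dvd_of_eq (by ring))))
    (fun t ht t' ht' h => eq_of_dvd_mul_sub c2 (t := t) (t' := t') (by omega) (by omega)
      (h.trans (dvd_of_eq (by ring))))
    (fun t ht t' ht' h => eq_of_dvd_mul_sub c3 (t := t) (t' := t') (by omega) (by omega)
      (h.trans (dvd_of_eq (by ring))))
    (fun t ht _ t' ht' h => eq_of_dvd_mul_sub c1 (t := t) (t' := t') (by omega) (by omega)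
      (h.trans (dvd_of_eq (by ring))))
  refine this.trans (le_of_eq ?_)
  rw [hn, Finset.card_empty]
  push_cast
  field_simp
  ring

/-- The density bound from `n` torus points of which, counted over the four directions, at most eight
fail to be alone on their line. -/
theorem patternDensity_le_of_card_le {k n : ℕ} (hk : 2 ≤ k) (hn : n = k + 1) {x y : ℕ → ℤ}
    (X D : Finset ℕ) (hX : X.card ≤ 4) (hD : D.card ≤ 4)
    (hx : ∀ t < n, t ∉ X → ∀ t' < n, (n : ℤ) ∣ x t - x t' → t = t')
    (hy : ∀ t < n, ∀ t' < n, (n : ℤ) ∣ y t - y t' → t = t')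
    (hs : ∀ t < n, ∀ t' < n, (n : ℤ) ∣ (x t + y t) - (x t' + y t') → t = t')
    (hd : ∀ t < n, t ∉ D → ∀ t' < n, (n : ℤ) ∣ (y t - x t) - (y t' - x t') → t = t') :
    patternDensity k ≤ (k : ℝ) * (k + 1) / (4 * (k - 1)) := by
  refine (patternDensity_le_of_torusPoints (by omega) hn X D (by omega) hx hy hs hd).trans ?_
  have hX' : (X.card : ℝ) ≤ 4 := by exact_mod_cast hX
  have hD' : (D.card : ℝ) ≤ 4 := by exact_mod_cast hD
  have hk' : (2 : ℝ) ≤ k := by exact_mod_cast hk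
  rw [hn]
  push_cast
  have e : ((k : ℝ) + 1) ^ 2 - (k + 1) = k * (k + 1) := by ring
  rw [e]
  -- The denominator is at least 4n - 8 = 4(k - 1).
  apply div_le_div_of_nonneg_left <;> nlinarith

/-- The shift makes y even on the first half and odd on the second; adding it to x keeps x + y = 3t.
The exceptions are the collisions at the jumps, cyclically. -/
theorem patternDensity_le_of_two_dvd_of_not_three_dvd {k : ℕ} (hk : 2 ≤ k) (h2 : 2 ∣ k + 1)
    (h3 : ¬ 3 ∣ k + 1) : patternDensity k ≤ (k : ℝ) * (k + 1) / (4 * (k - 1)) := by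
  obtain ⟨n, hn⟩ : ∃ n, n = k + 1 := ⟨_, rfl⟩
  rw [← hn] at h2 h3
  have c3 : IsCoprime (n : ℤ) 3 := isCoprime_three_of_not_dvd (by exact_mod_cast h3)
  obtain ⟨m, hm⟩ := h2
  refine patternDensity_le_of_card_le hk hn
    (x := fun t => t + halfStep n t) (y := fun t => 2 * t - halfStep n t)
    {0, n - 1} {m - 2, m - 1, m, m + 1} (Finset.card_le_two.trans (by norm_num))
    Finset.card_le_four ?_ ?_ ?_ ?_
  · intro t ht hX t' ht' h
    simp only [Finset.mem_insert, Finset.mem_singleton, not_or] at hX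
    have a := halfStep_spec n t
    have a' := halfStep_spec n t'
    have := Int.eq_or_of_dvd_of_lt_two_mul h (by omega) (by omega)
    omega
  · intro t ht t' ht' h
    have a := halfStep_spec n t
    have a' := halfStep_spec n t'
    have := Int.eq_or_of_dvd_of_lt_two_mul h (by omega) (by omega)
    omega
  · intro t ht t' ht' h
    exact eq_of_dvd_mul_sub c3 (by omega) (by omega) (h.trans (dvd_of_eq (by ring)))
  · intro t ht hD t' ht' h
    simp only [Finset.mem_insert, Finset.mem_singleton, not_or] at hD
    have a := halfStep_spec n t
    have a' := halfStep_spec n t'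
    have := Int.eq_or_of_dvd_of_lt_two_mul h (by omega) (by omega)
    omega

/-- The sum x + y = 3t - `thirdStep n t` takes a different residue modulo 3 on each third. -/
theorem patternDensity_le_of_not_two_dvd_of_three_dvd {k : ℕ} (hk : 2 ≤ k) (h2 : ¬ 2 ∣ k + 1)
    (h3 : 3 ∣ k + 1) : patternDensity k ≤ (k : ℝ) * (k + 1) / (4 * (k - 1)) := by
  obtain ⟨n, hn⟩ : ∃ n, n = k + 1 := ⟨_, rfl⟩
  rw [← hn] at h2 h3
  have c2 : IsCoprime (n : ℤ) 2 := isCoprime_two_of_odd (by exact_mod_cast h2)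
  obtain ⟨r, hr⟩ := h3
  refine patternDensity_le_of_card_le hk hn
    (x := fun t => t - thirdStep n t) (y := fun t => 2 * t)
    {r - 1, r, 2 * r - 1, 2 * r} {0, 1, n - 2, n - 1} Finset.card_le_four
    Finset.card_le_four ?_ ?_ ?_ ?_
  · intro t ht hX t' ht' h
    simp only [Finset.mem_insert, Finset.mem_singleton, not_or] at hX
    have a := thirdStep_spec n t
    have a' := thirdStep_spec n t'
    have := Int.eq_or_of_dvd_of_lt_two_mul h (by omega) (by omega)
    omega
  · intro t ht t' ht' h
    exact eq_of_dvd_mul_sub c2 (by omega) (by omega) (h.trans (dvd_of_eq (by ring)))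
  · intro t ht t' ht' h
    have a := thirdStep_spec n t
    have a' := thirdStep_spec n t'
    have := Int.eq_or_of_dvd_of_lt_three_mul h (by omega) (by omega)
    omega
  · intro t ht hD t' ht' h
    simp only [Finset.mem_insert, Finset.mem_singleton, not_or] at hD
    have a := thirdStep_spec n t
    have a' := thirdStep_spec n t'
    have := Int.eq_or_of_dvd_of_lt_two_mul h (by omega) (by omega)
    omega

/-- Both corrections combined: y is repaired by the half step, x + y = 3t - `thirdStep n t` by the
third step. -/
theorem patternDensity_le_of_two_dvd_of_three_dvd {k : ℕ} (hk : 2 ≤ k) (h2 : 2 ∣ k + 1)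
    (h3 : 3 ∣ k + 1) : patternDensity k ≤ (k : ℝ) * (k + 1) / (4 * (k - 1)) := by
  obtain ⟨n, hn⟩ : ∃ n, n = k + 1 := ⟨_, rfl⟩
  rw [← hn] at h2 h3
  obtain ⟨r, hr⟩ : ∃ r, n = 6 * r := ⟨n / 6, by omega⟩
  refine patternDensity_le_of_card_le hk hn
    (x := fun t => t + halfStep n t - thirdStep n t) (y := fun t => 2 * t - halfStep n t)
    {2 * r - 1, 2 * r, 4 * r - 1, 4 * r} {3 * r - 2, 3 * r - 1, 3 * r, 3 * r + 1}
    Finset.card_le_four Finset.card_le_four ?_ ?_ ?_ ?_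
  · intro t ht hX t' ht' h
    simp only [Finset.mem_insert, Finset.mem_singleton, not_or] at hX
    have a := thirdStep_spec n t
    have a' := thirdStep_spec n t'
    have b := halfStep_spec n t
    have b' := halfStep_spec n t'
    have := Int.eq_or_of_dvd_of_lt_two_mul h (by omega) (by omega)
    omega
  · intro t ht t' ht' h
    have b := halfStep_spec n t
    have b' := halfStep_spec n t'
    have := Int.eq_or_of_dvd_of_lt_two_mul h (by omega) (by omega)
    omega
  · intro t ht t' ht' h
    have a := thirdStep_spec n t
    have a' := thirdStep_spec n t'
    have := Int.eq_or_of_dvd_of_lt_three_mul h (by omega) (by omega)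
    omega
  · intro t ht hD t' ht' h
    simp only [Finset.mem_insert, Finset.mem_singleton, not_or] at hD
    have a := thirdStep_spec n t
    have a' := thirdStep_spec n t'
    have b := halfStep_spec n t
    have b' := halfStep_spec n t'
    have := Int.eq_or_of_dvd_of_lt_two_mul h (by omega) (by omega)
    omega

theorem patternDensity_le_of_two_dvd_of_not_four_dvd {k : ℕ} (hk : 1 ≤ k) (h2 : 2 ∣ k + 1)
    (h4 : ¬ 4 ∣ k + 1) (h3 : ¬ 3 ∣ k + 1) :
    patternDensity k ≤ ((k : ℝ) * (k + 1) + 1) / (4 * k) := by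
  obtain ⟨m, hm⟩ := h2
  have c2 : IsCoprime (m : ℤ) 2 := isCoprime_two_of_odd (by omega)
  have c3 : IsCoprime (m : ℤ) 3 := isCoprime_three_of_not_dvd (by omega)
  have c1 : IsCoprime (m : ℤ) 1 := isCoprime_one_right
  obtain ⟨q, hq⟩ : ∃ q : ℤ, (m : ℤ) = 2 * q + 1 := ⟨m / 2, by omega⟩
  have hn : 2 * m = k + 1 := hm.symm
  set x : ℕ → ℤ := fun i => if i < m then i else i + 1 with hx
  set y : ℕ → ℤ := fun i => if i < m then (m + 2) * i else (m + 2) * (i - m) + m with hy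
  -- Here δ says which half the index i lies in, and u is its offset there. The value x = m is
  -- skipped, hence k = 2m - 1 points.
  have spec : ∀ i < k, ∃ (u : ℕ) (δ : ℤ), (δ = 0 ∨ δ = 1) ∧ u + δ < m ∧ (i : ℤ) = u + δ * m ∧
      x i = u + δ * (m + 1) ∧ y i = (m + 2) * u + δ * m := by
    intro i hi
    by_cases h : i < m
    · exact ⟨i, 0, by simp, by omega, by simp, by simp [hx, h], by simp [hy, h]⟩
    · obtain ⟨u, rfl⟩ := Nat.exists_eq_add_of_le (not_lt.1 h)
      refine ⟨u, 1, by simp, by omega, by push_cast; ring, ?_, ?_⟩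
      · simp [hx]; ring
      · simp [hy]
  have key : ∀ i < k, ∀ j < k, ∀ c : ℤ, IsCoprime (m : ℤ) c → ∀ (u v : ℕ) (δ ε : ℤ),
      (δ = 0 ∨ δ = 1) → (ε = 0 ∨ ε = 1) → u + δ < m → v + ε < m → (i : ℤ) = u + δ * m →
      (j : ℤ) = v + ε * m → (m : ℤ) ∣ c * ((u : ℤ) - v) → δ = ε → i = j := by
    intro i _ j _ c hc u v δ ε hδ hε hu hv hi hj hdvd hδε
    have : u = v := eq_of_dvd_mul_sub hc (by omega) (by omega) hdvd
    subst this hδε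
    omega
  have hdvd : (m : ℤ) ∣ ((2 * m : ℕ) : ℤ) := ⟨2, by push_cast; ring⟩
  have hdvd2 : (2 : ℤ) ∣ ((2 * m : ℕ) : ℤ) := ⟨m, by push_cast; ring⟩
  have := patternDensity_le_of_torusPoints (N := k) hk hn (x := x) (y := y) ∅ ∅ (by simp; omega)
    ?_ ?_ ?_ ?_
  · refine this.trans (le_of_eq ?_)
    rw [Finset.card_empty]
    push_cast
    ring
  · intro i hi _ j hj h
    obtain ⟨u, δ, hδ, hu, hi', hxi, hyi⟩ := spec i hi
    obtain ⟨v, ε, hε, hv, hj', hxj, hyj⟩ := spec j hj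
    have := Int.eq_or_of_dvd_of_lt_two_mul h (by simp only [hx]; split_ifs <;> omega)
      (by simp only [hx]; split_ifs <;> omega)
    simp only [hx] at this
    split_ifs at this <;> omega
  · intro i hi j hj h
    obtain ⟨u, δ, hδ, hu, hi', hxi, hyi⟩ := spec i hi
    obtain ⟨v, ε, hε, hv, hj', hxj, hyj⟩ := spec j hj
    rw [hyi, hyj] at h
    have h2 : (m : ℤ) ∣ 2 * ((u : ℤ) - v) := by
      have := dvd_sub (hdvd.trans h) (dvd_mul_left (m : ℤ) ((u : ℤ) - v + δ - ε))
      exact this.trans (dvd_of_eq (by ring))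
    -- Modulo m, y is 2u and determines u; then the term δ * m modulo 2m determines δ.
    refine key i hi j hj 2 c2 u v δ ε hδ hε hu hv hi' hj' h2 ?_
    have huv : u = v := eq_of_dvd_mul_sub c2 (by omega) (by omega) h2
    subst huv
    have h' : ((2 * m : ℕ) : ℤ) ∣ (δ - ε) * m := h.trans (dvd_of_eq (by ring))
    rcases hδ with rfl | rfl <;> rcases hε with rfl | rfl
    · rfl
    · exact absurd (Int.le_of_dvd (by omega) ((dvd_neg.2 h').trans (dvd_of_eq (by ring :
        -((0 - 1) * (m : ℤ)) = m)))) (by push_cast; omega)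
    · exact absurd (Int.le_of_dvd (by omega) (h'.trans (dvd_of_eq (by ring :
        ((1 - 0) * (m : ℤ)) = m)))) (by push_cast; omega)
    · rfl
  · intro i hi j hj h
    obtain ⟨u, δ, hδ, hu, hi', hxi, hyi⟩ := spec i hi
    obtain ⟨v, ε, hε, hv, hj', hxj, hyj⟩ := spec j hj
    rw [hxi, hyi, hxj, hyj] at h
    -- As m is odd, x + y has the parity of δ; modulo m it is 3u + δ, which then gives u.
    have hδε : δ = ε := by
      have := dvd_sub (hdvd2.trans h) (dvd_mul_right 2 ((q + 2) * ((u : ℤ) - v) + (δ - ε) * m))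
      have : (2 : ℤ) ∣ δ - ε := this.trans (dvd_of_eq (by rw [hq]; ring))
      omega
    refine key i hi j hj 3 c3 u v δ ε hδ hε hu hv hi' hj' ?_ hδε
    subst hδε
    have := dvd_sub (hdvd.trans h) (dvd_mul_left (m : ℤ) ((u : ℤ) - v))
    exact this.trans (dvd_of_eq (by ring))
  · intro i hi _ j hj h
    obtain ⟨u, δ, hδ, hu, hi', hxi, hyi⟩ := spec i hi
    obtain ⟨v, ε, hε, hv, hj', hxj, hyj⟩ := spec j hj
    rw [hxi, hyi, hxj, hyj] at h
    -- Likewise y - x has the parity of δ, and is u - δ modulo m.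
    have hδε : δ = ε := by
      have := dvd_sub (hdvd2.trans h) (dvd_mul_right 2 ((q + 1) * ((u : ℤ) - v)))
      have : (2 : ℤ) ∣ ε - δ := this.trans (dvd_of_eq (by rw [hq]; ring))
      omega
    refine key i hi j hj 1 c1 u v δ ε hδ hε hu hv hi' hj' ?_ hδε
    subst hδε
    have := dvd_sub (hdvd.trans h) (dvd_mul_left (m : ℤ) ((u : ℤ) - v))
    exact this.trans (dvd_of_eq (by ring))

theorem theorem4 (k : ℕ) (hk : 1 ≤ k) :
    Tendsto (fun n : ℕ => (minPoints k n : ℝ) / n) atTop (𝓝 (patternDensity k)) ∧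
    (2 ≤ k → patternDensity k ≤ ((k : ℝ) * (k + 1) + 2) / (4 * ((k : ℝ) - 1))) ∧
    (¬ 3 ∣ k + 1 → ¬ 4 ∣ k + 1 →
      patternDensity k ≤ ((k : ℝ) * (k + 1) + 1) / (4 * (k : ℝ))) := by
  refine ⟨tendsto_minPoints_div hk, fun hk2 => ?_, fun h3 h4 => ?_⟩
  · have hk' : (2 : ℝ) ≤ k := by exact_mod_cast hk2
    have hle : patternDensity k ≤ (k : ℝ) * (k + 1) / (4 * (k - 1)) := by
      by_cases h2 : 2 ∣ k + 1 <;> by_cases h3 : 3 ∣ k + 1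
      · exact patternDensity_le_of_two_dvd_of_three_dvd hk2 h2 h3
      · exact patternDensity_le_of_two_dvd_of_not_three_dvd hk2 h2 h3
      · exact patternDensity_le_of_not_two_dvd_of_three_dvd hk2 h2 h3
      · refine (patternDensity_le_of_coprime hk h2 h3).trans ?_
        rw [div_le_div_iff₀ (by norm_num) (by linarith)]
        nlinarith
    refine hle.trans ?_
    have : (0 : ℝ) < 4 * ((k : ℝ) - 1) := by linarith
    gcongr
    linarith
  · by_cases h2 : 2 ∣ k + 1
    · exact patternDensity_le_of_two_dvd_of_not_four_dvd hk h2 h4 h3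
    · refine (patternDensity_le_of_coprime hk h2 h3).trans ?_
      have hk' : (1 : ℝ) ≤ k := by exact_mod_cast hk
      rw [div_le_div_iff₀ (by norm_num) (by linarith)]
      nlinarith
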